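/- Let $\rho$ run over the nontrivial zeros of the Riemann zeta function $\zeta$, i.e. the zeros with $0<\operatorname{Re}\rho<1$, each counted with its multiplicity $m(\rho)$, and let $\sum_\rho f(\rho)$ denote $\lim_{T\to\infty}\sum_{|\operatorname{Im}\rho|\le T} f(\rho)$. For $n\ge 1$ put $$\lambda(n)=\sum_\rho\Bigl(1-\bigl(1-\tfrac1\rho\bigr)^n\Bigr),$$ and for $n>1$ put $$\Delta(n)=\sum_\rho(-1)^{n-1}\frac1{\rho^n}.$$ Then: 1. the limit defining $\lambda(n)$ exists for every $n\ge 1$, and the series defining $\Delta(n)$ converges absolutely for every $n>1$ (so that $\Delta(n)$ is also its unordered sum); 2. for every $n>1$ and every nontrivial zero $\rho$, $$1-\bigl(1-\tfrac1\rho\bigr)^n=\sum_{k=1}^{n-1}(-1)^{k-n+1}\binom nk\Bigl(1-\bigl(1-\tfrac1\rho\bigr)^k\Bigr)+(-1)^{n-1}\frac1{\rho^n};$$ 3. for every $n>1$, $$\lambda(n)=\sum_{k=1}^{n-1}(-1)^{k-n+1}\binom nk\,\lambda(k)+\Delta(n).$$ -/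

import Mathlib

open Filter Topology

namespace LiKeiper

/-- The nontrivial zeros of the Riemann zeta function: its zeros in the open critical strip. -/
def nontrivialZeros : Set ℂ :=
  {ρ : ℂ | riemannZeta ρ = 0 ∧ 0 < ρ.re ∧ ρ.re < 1}

/-- Only finitely many nontrivial zeros have imaginary part of absolute value at most `T`. -/
theorem finite_nontrivialZeros (T : ℝ) :
    {ρ : ℂ | ρ ∈ nontrivialZeros ∧ |ρ.im| ≤ T}.Finite := by
  have hK : IsCompact (Set.Icc (0 : ℝ) 1 ×ℂ Set.Icc (-T) T) :=
    isCompact_Icc.reProdIm isCompact_Icc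
  refine hK.inter_riemannZetaZeros_finite.subset ?_
  rintro ρ ⟨⟨h0, h1, h2⟩, h3⟩
  exact ⟨Complex.mem_reProdIm.2 ⟨⟨h1.le, h2.le⟩, abs_le.1 h3⟩, h0⟩

/-- The finite set of distinct nontrivial zeros `ρ` with `|Im ρ| ≤ T`. -/
noncomputable def zerosUpTo (T : ℝ) : Finset ℂ :=
  (finite_nontrivialZeros T).toFinset

/-- The multiplicity of `ρ` as a zero of the Riemann zeta function. -/
noncomputable def multiplicity (ρ : ℂ) : ℕ :=
  analyticOrderNatAt riemannZeta ρ

/-- The sum of `f ρ` over the nontrivial zeros with `|Im ρ| ≤ T`, each zero being counted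
with its multiplicity. -/
noncomputable def partialSum (f : ℂ → ℂ) (T : ℝ) : ℂ :=
  ∑ ρ ∈ zerosUpTo T, (multiplicity ρ : ℂ) * f ρ

/-- `∑_ρ f ρ` over all nontrivial zeros counted with multiplicity, in the usual sense of
the limit of the partial sums over `|Im ρ| ≤ T` as `T → ∞`. -/
noncomputable def zeroSum (f : ℂ → ℂ) : ℂ :=
  limUnder atTop (partialSum f)

/-- The contribution `1 - (1 - 1/ρ)^n` of a single zero `ρ` to the `n`-th coefficient. -/
noncomputable def liTerm (n : ℕ) (ρ : ℂ) : ℂ :=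
  1 - (1 - 1 / ρ) ^ n

/-- The contribution `(-1)^(n-1) / ρ^n` of a single zero `ρ` to the remainder. -/
noncomputable def deltaTerm (n : ℕ) (ρ : ℂ) : ℂ :=
  (-1 : ℂ) ^ ((n : ℤ) - 1) * (1 / ρ ^ n)

/-- The Li–Keiper coefficient `λ(n) = ∑_ρ (1 - (1 - 1/ρ)^n)`. -/
noncomputable def liKeiper (n : ℕ) : ℂ :=
  zeroSum (liTerm n)

/-- The remainder `Δ(n) = ∑_ρ (-1)^(n-1) / ρ^n`. -/
noncomputable def delta (n : ℕ) : ℂ :=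
  zeroSum (deltaTerm n)

end LiKeiper

/-! With `x = 1 - 1/ρ`, the single-zero identity is binomial inversion: expand `(1 - x)^n` and
isolate the top term (`one_sub_pow_eq_sum`). Summing over zeros needs two convergence facts. For
`Δ(n)`, absolute convergence reduces to `∑ m(ρ)/|ρ|² < ∞`. The function `xi` is entire, `xi 0 = -1`,
and its growth is at most factorial in the radius. Jensen's bound then gives `O((k+1) 2^k)` zeros in
`|ρ| ≤ 2^k`, and a dyadic sum finishes (`summable_multiplicity_div_norm_sq`). For `λ(1)`, the sum of
`1/ρ` is handled only along symmetric truncations: pairing `ρ` with `1 - ρ` turns it into half the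
absolutely convergent sum of `1/(ρ(1-ρ))`. The recurrence then gives every `λ(n)` by strong
induction. -/

namespace LiKeiper

open Complex MeasureTheory Set

/-! ### The entire function `ξ` -/

/-- The entire function `s (1 - s) Λ(s)`, where `Λ` is the completed Riemann zeta function. -/
noncomputable def xi (s : ℂ) : ℂ :=
  -- `Λ = Λ₀ - 1/s - 1/(1-s)`, and `s(1-s)(1/s + 1/(1-s)) = 1`, so the poles cancel.
  s * (1 - s) * completedRiemannZeta₀ s - 1

theorem differentiable_xi : Differentiable ℂ xi := by
  unfold xi
  have := differentiable_completedZeta₀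
  fun_prop

@[simp]
theorem xi_zero : xi 0 = -1 := by simp [xi]

theorem xi_one_sub (s : ℂ) : xi (1 - s) = xi s := by
  rw [xi, xi, completedRiemannZeta₀_one_sub]
  ring

theorem xi_eq_mul_completedRiemannZeta {s : ℂ} (h0 : s ≠ 0) (h1 : s ≠ 1) :
    xi s = s * (1 - s) * completedRiemannZeta s := by
  have h2 : 1 - s ≠ 0 := sub_ne_zero.2 h1.symm
  rw [xi, completedRiemannZeta_eq]
  field_simp
  ring

theorem ne_zero_of_mem {ρ : ℂ} (h : ρ ∈ nontrivialZeros) : ρ ≠ 0 := by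
  rintro rfl
  simpa using h.2.1

theorem ne_one_of_mem {ρ : ℂ} (h : ρ ∈ nontrivialZeros) : ρ ≠ 1 := by
  rintro rfl
  simpa using h.2.2

theorem riemannZeta_eq_mul_xi {s : ℂ} (h0 : s ≠ 0) (h1 : s ≠ 1) :
    riemannZeta s = (Gammaℝ s)⁻¹ * (s * (1 - s))⁻¹ * xi s := by
  have h2 : 1 - s ≠ 0 := sub_ne_zero.2 h1.symm
  rw [riemannZeta_def_of_ne_zero h0, xi_eq_mul_completedRiemannZeta h0 h1]
  field_simp

theorem mem_nontrivialZeros_iff {ρ : ℂ} :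
    ρ ∈ nontrivialZeros ↔ xi ρ = 0 ∧ 0 < ρ.re ∧ ρ.re < 1 := by
  refine and_congr_left fun ⟨hl, hr⟩ ↦ ?_
  have h0 : ρ ≠ 0 := by rintro rfl; simp at hl
  have h1 : ρ ≠ 1 := by rintro rfl; simp at hr
  have h2 : 1 - ρ ≠ 0 := sub_ne_zero.2 h1.symm
  rw [riemannZeta_eq_mul_xi h0 h1]
  simp [Gammaℝ_ne_zero_of_re_pos hl, h0, h2]

theorem one_sub_mem_nontrivialZeros {ρ : ℂ} (h : ρ ∈ nontrivialZeros) :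
    1 - ρ ∈ nontrivialZeros := by
  obtain ⟨h0, hl, hr⟩ := mem_nontrivialZeros_iff.1 h
  refine mem_nontrivialZeros_iff.2 ⟨by rw [xi_one_sub, h0], ?_, ?_⟩ <;> simp <;> linarith

/-- Near `ρ`, `ζ` is `xi` times an analytic factor that does not vanish at `ρ`, so orders agree. -/
theorem multiplicity_eq_analyticOrderNatAt_xi {ρ : ℂ} (h : ρ ∈ nontrivialZeros) :
    multiplicity ρ = analyticOrderNatAt xi ρ := by
  have h0 := ne_zero_of_mem h
  have h1 := ne_one_of_mem h
  have h2 : 1 - ρ ≠ 0 := sub_ne_zero.2 h1.symm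
  set g : ℂ → ℂ := fun s ↦ (Gammaℝ s)⁻¹ * (s * (1 - s))⁻¹ with hg
  have hga : AnalyticAt ℂ g ρ := by
    refine (differentiable_Gammaℝ_inv.analyticAt ρ).mul (AnalyticAt.inv ?_ (mul_ne_zero h0 h2))
    fun_prop
  have hg0 : g ρ ≠ 0 :=
    mul_ne_zero (inv_ne_zero (Gammaℝ_ne_zero_of_re_pos h.2.1)) (inv_ne_zero (mul_ne_zero h0 h2))
  have hcongr : riemannZeta =ᶠ[𝓝 ρ] g * xi := by
    filter_upwards [eventually_ne_nhds h0, eventually_ne_nhds h1] with s hs0 hs1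
    exact riemannZeta_eq_mul_xi hs0 hs1
  rw [multiplicity, analyticOrderNatAt, analyticOrderNatAt, analyticOrderAt_congr hcongr,
    analyticOrderAt_mul hga (differentiable_xi.analyticAt ρ), hga.analyticOrderAt_eq_zero.2 hg0,
    zero_add]

theorem multiplicity_one_sub {ρ : ℂ} (h : ρ ∈ nontrivialZeros) :
    multiplicity (1 - ρ) = multiplicity ρ := by
  have hcomp : xi ∘ (fun s ↦ 1 - s) = xi := funext xi_one_sub
  have hd : deriv (fun s : ℂ ↦ 1 - s) ρ ≠ 0 := by simp
  have := analyticOrderAt_comp_of_deriv_ne_zero (f := xi) (g := fun s : ℂ ↦ 1 - s) (z₀ := ρ)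
    (by fun_prop) hd
  rw [multiplicity_eq_analyticOrderNatAt_xi h,
    multiplicity_eq_analyticOrderNatAt_xi (one_sub_mem_nontrivialZeros h), analyticOrderNatAt,
    analyticOrderNatAt, ← this, hcomp]

/-! ### Growth of `ξ` -/

theorem norm_cpow_sub_one_le {t : ℝ} (ht : 0 < t) {s : ℂ} {a b : ℝ} (ha : a ≤ s.re)
    (hb : s.re ≤ b) : ‖(t : ℂ) ^ (s - 1)‖ ≤ ‖(t : ℂ) ^ ((a : ℂ) - 1)‖ + ‖(t : ℂ) ^ ((b : ℂ) - 1)‖ := by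
  simp only [norm_cpow_eq_rpow_re_of_pos ht, sub_re, one_re, ofReal_re]
  have h1 := Real.rpow_nonneg ht.le (a - 1)
  have h2 := Real.rpow_nonneg ht.le (b - 1)
  rcases le_total t 1 with h | h
  · linarith [Real.rpow_le_rpow_of_exponent_ge ht h (by linarith : a - 1 ≤ s.re - 1)]
  · linarith [Real.rpow_le_rpow_of_exponent_le h (by linarith : s.re - 1 ≤ b - 1)]

/-- A Mellin transform is bounded on every closed vertical strip in whose boundary points it
converges absolutely. -/
theorem exists_norm_mellin_le {f : ℝ → ℂ} {a b : ℝ} (ha : MellinConvergent f a)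
    (hb : MellinConvergent f b) :
    ∃ C, ∀ s : ℂ, a ≤ s.re → s.re ≤ b → ‖mellin f s‖ ≤ C := by
  refine ⟨∫ t in Ioi (0 : ℝ), (‖(t : ℂ) ^ ((a : ℂ) - 1) • f t‖ + ‖(t : ℂ) ^ ((b : ℂ) - 1) • f t‖),
    fun s hsa hsb ↦ ?_⟩
  refine norm_integral_le_of_norm_le (ha.norm.add hb.norm) ?_
  filter_upwards [ae_restrict_mem measurableSet_Ioi] with t ht
  rw [norm_smul, norm_smul, norm_smul, ← add_mul]
  gcongr
  exact norm_cpow_sub_one_le ht hsa hsb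

/-- `Λ₀` is, up to scaling, the Mellin transform of a modified theta kernel, which converges for
every exponent. -/
theorem exists_norm_completedRiemannZeta₀_le_of_re_mem_Icc (a b : ℝ) :
    ∃ C, ∀ s : ℂ, a ≤ s.re → s.re ≤ b → ‖completedRiemannZeta₀ s‖ ≤ C := by
  set P := HurwitzZeta.hurwitzEvenFEPair 0
  have hP := P.isStrongFEPair_toStrongFEPair
  obtain ⟨C, hC⟩ := exists_norm_mellin_le (a := a / 2) (b := b / 2) (f := P.f_modif)
    (hP.hasMellin _).1 (hP.hasMellin _).1
  refine ⟨C / 2, fun s hsa hsb ↦ ?_⟩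
  change ‖mellin P.f_modif (s / 2) / 2‖ ≤ C / 2
  rw [norm_div, Complex.norm_ofNat]
  have hre : (s / 2).re = s.re / 2 := by simp
  gcongr
  exact hC _ (by rw [hre]; linarith) (by rw [hre]; linarith)

theorem norm_Gamma_le_Gamma_re {s : ℂ} (hs : 0 < s.re) : ‖Complex.Gamma s‖ ≤ Real.Gamma s.re := by
  rw [Complex.Gamma_eq_integral hs, Complex.GammaIntegral, Real.Gamma_eq_integral hs]
  refine norm_integral_le_of_norm_le (Real.GammaIntegral_convergent hs) ?_
  filter_upwards [ae_restrict_mem measurableSet_Ioi] with t ht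
  rw [norm_mul, norm_cpow_eq_rpow_re_of_pos ht, Complex.norm_real,
    Real.norm_of_nonneg (Real.exp_pos _).le]
  simp

theorem norm_riemannZeta_le {s : ℂ} (hs : 2 ≤ s.re) :
    ‖riemannZeta s‖ ≤ ∑' n : ℕ, 1 / (n : ℝ) ^ 2 := by
  have hsum : Summable fun n : ℕ ↦ 1 / (n : ℝ) ^ 2 := Real.summable_one_div_nat_pow.2 (by norm_num)
  rw [zeta_eq_tsum_one_div_nat_cpow (by linarith)]
  refine tsum_of_norm_bounded hsum.hasSum fun n ↦ ?_
  rcases n.eq_zero_or_pos with rfl | hn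
  · rw [Nat.cast_zero, zero_cpow (by rintro rfl; norm_num at hs)]
    simp
  · rw [norm_div, norm_one, norm_natCast_cpow_of_pos hn]
    gcongr
    rw [← Real.rpow_natCast]
    exact Real.rpow_le_rpow_of_exponent_le (by exact_mod_cast hn) (by exact_mod_cast hs)

theorem norm_completedRiemannZeta_le {s : ℂ} {N : ℕ} (hs : 4 ≤ s.re) (hN : s.re ≤ 2 * (N + 1)) :
    ‖completedRiemannZeta s‖ ≤ (∑' n : ℕ, 1 / (n : ℝ) ^ 2) * N.factorial := by
  have h0 : s ≠ 0 := by rintro rfl; norm_num at hs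
  have hre : (s / 2).re = s.re / 2 := by simp
  have hpos : 0 < s.re := by linarith
  have hG : ‖Gammaℝ s‖ ≤ N.factorial := by
    rw [Gammaℝ_def, norm_mul, norm_cpow_eq_rpow_re_of_pos Real.pi_pos]
    have h1 : Real.pi ^ (-s / 2).re ≤ 1 := by
      refine Real.rpow_le_one_of_one_le_of_nonpos (by linarith [Real.pi_gt_three]) ?_
      have : (-s / 2).re = -(s.re / 2) := by simp [neg_div]
      linarith
    have h2 : ‖Complex.Gamma (s / 2)‖ ≤ N.factorial := by
      refine (norm_Gamma_le_Gamma_re (by rw [hre]; linarith)).trans ?_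
      rw [hre, ← Real.Gamma_nat_eq_factorial]
      -- `Γ` is increasing only from `2` on here, hence the hypothesis `4 ≤ s.re`.
      refine Real.Gamma_strictMonoOn_Ici.monotoneOn ?_ ?_ (by linarith) <;>
        rw [mem_Ici] <;> linarith
    calc _ ≤ 1 * (N.factorial : ℝ) := by gcongr
      _ = _ := one_mul _
  have hz : completedRiemannZeta s = riemannZeta s * Gammaℝ s := by
    rw [riemannZeta_def_of_ne_zero h0, div_mul_cancel₀ _ (Gammaℝ_ne_zero_of_re_pos hpos)]
  rw [hz, norm_mul]
  have := norm_riemannZeta_le (s := s) (by linarith)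
  gcongr

theorem exists_norm_completedRiemannZeta₀_le :
    ∃ C, 1 ≤ C ∧ ∀ (N : ℕ) (s : ℂ), ‖s‖ ≤ 2 * N → ‖completedRiemannZeta₀ s‖ ≤ C * N.factorial := by
  obtain ⟨A, hA⟩ := exists_norm_completedRiemannZeta₀_le_of_re_mem_Icc 0 4
  set Z := ∑' n : ℕ, 1 / (n : ℝ) ^ 2
  have hZ : 0 ≤ Z := tsum_nonneg fun n ↦ by positivity
  -- The bound `2(N+1)` rather than `2N` leaves room for the reflection `s ↦ 1 - s`.
  have key (N : ℕ) (s : ℂ) (h0 : 0 ≤ s.re) (hs : s.re ≤ 2 * (N + 1)) :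
      ‖completedRiemannZeta₀ s‖ ≤ (|A| + Z + 2) * N.factorial := by
    have hf : (1 : ℝ) ≤ N.factorial := by exact_mod_cast N.factorial_pos
    rcases le_total s.re 4 with h4 | h4
    · have := (hA s h0 h4).trans (le_abs_self A)
      nlinarith [abs_nonneg A]
    · have h1 : 1 ≤ ‖s‖ := by linarith [Complex.re_le_norm s]
      have h2 : 1 ≤ ‖1 - s‖ := by
        have := Complex.abs_re_le_norm (1 - s)
        rw [sub_re, one_re, abs_of_nonpos (by linarith)] at this
        linarith
      have h3 : completedRiemannZeta₀ s = completedRiemannZeta s + 1 / s + 1 / (1 - s) := by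
        rw [completedRiemannZeta_eq]; ring
      have h5 : ‖1 / s‖ ≤ 1 := by
        rw [norm_div, norm_one]; exact div_le_one_of_le₀ h1 (norm_nonneg _)
      have h6 : ‖1 / (1 - s)‖ ≤ 1 := by
        rw [norm_div, norm_one]; exact div_le_one_of_le₀ h2 (norm_nonneg _)
      have h7 := norm_completedRiemannZeta_le h4 hs
      rw [h3]
      refine norm_add₃_le.trans ?_
      nlinarith [abs_nonneg A]
  refine ⟨|A| + Z + 2, by linarith [abs_nonneg A], fun N s hs ↦ ?_⟩
  have hre := abs_le.1 ((Complex.abs_re_le_norm s).trans hs)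
  rcases le_total 0 s.re with h | h
  · exact key N s h (by linarith)
  · rw [← completedRiemannZeta₀_one_sub]
    refine key N _ ?_ ?_ <;> rw [sub_re, one_re] <;> linarith

theorem exists_norm_xi_le :
    ∃ C, 1 ≤ C ∧ ∀ (k : ℕ) (s : ℂ), ‖s‖ ≤ 2 * 2 ^ k →
      ‖xi s‖ ≤ C * 2 ^ (2 * k) * (2 ^ k : ℕ).factorial := by
  obtain ⟨C, hC, h⟩ := exists_norm_completedRiemannZeta₀_le
  refine ⟨6 * C + 1, by linarith, fun k s hs ↦ ?_⟩
  have h1 := h (2 ^ k) s (by exact_mod_cast hs)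
  have hx : (1 : ℝ) ≤ 2 ^ k := one_le_pow₀ (by norm_num)
  have hf : (1 : ℝ) ≤ (2 ^ k : ℕ).factorial := by exact_mod_cast (2 ^ k : ℕ).factorial_pos
  have h2 : ‖1 - s‖ ≤ 3 * 2 ^ k := (norm_sub_le _ _).trans (by rw [norm_one]; linarith)
  have h3 : ‖s * (1 - s) * completedRiemannZeta₀ s‖ ≤
      (2 * 2 ^ k) * (3 * 2 ^ k) * (C * (2 ^ k : ℕ).factorial) := by
    rw [norm_mul, norm_mul]
    gcongr
  rw [xi]
  refine (norm_sub_le _ _).trans ?_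
  rw [norm_one, two_mul k, pow_add]
  have h4 : (1 : ℝ) ≤ 2 ^ k * 2 ^ k * (2 ^ k : ℕ).factorial :=
    one_le_mul_of_one_le_of_one_le (one_le_mul_of_one_le_of_one_le hx hx) hf
  nlinarith

/-! ### Counting the zeros -/

/-- Jensen's inequality on radii `r` and `2r`, normalised by `|xi 0| = 1`. -/
theorem sum_multiplicity_le {S : Finset ℂ} (hS : ∀ ρ ∈ S, ρ ∈ nontrivialZeros) {r M : ℝ}
    (hr : 0 < r) (hSr : ∀ ρ ∈ S, ‖ρ‖ ≤ r) (hM : 1 ≤ M)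
    (hbound : ∀ z : ℂ, ‖z‖ ≤ 2 * r → ‖xi z‖ ≤ M) :
    ∑ ρ ∈ S, (multiplicity ρ : ℝ) ≤ Real.log M / Real.log 2 := by
  have hana (R : ℝ) : AnalyticOnNhd ℂ xi (Metric.closedBall 0 R) :=
    fun z _ ↦ differentiable_xi.analyticAt z
  have hJ := AnalyticOnNhd.sum_divisor_le (c := 0) (r := r) (R := 2 * r) (M := M) (f := xi)
    (by positivity) (by rw [abs_of_pos hr, abs_of_pos (by positivity)]; linarith) hM (hana _)
    (by simp) (fun z hz ↦ hbound z (by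
      rw [mem_sphere_zero_iff_norm, abs_of_pos (by positivity)] at hz; exact hz.le))
  rw [abs_of_pos hr, xi_zero, norm_neg, norm_one, div_one, mul_div_assoc, div_self hr.ne',
    mul_one] at hJ
  refine le_trans ?_ hJ
  set D := MeromorphicOn.divisor xi (Metric.closedBall 0 r)
  have hD : ∀ ρ ∈ S, ((multiplicity ρ : ℕ) : ℤ) = D ρ := fun ρ hρ ↦ by
    rw [MeromorphicOn.AnalyticOnNhd.divisor_apply (hana r) (by simpa using hSr ρ hρ),
      multiplicity_eq_analyticOrderNatAt_xi (hS ρ hρ), analyticOrderNatAt]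
    cases analyticOrderAt xi ρ <;> simp
  have hfin : D.support.Finite := D.finiteSupport (isCompact_closedBall 0 r)
  have hnn : ∀ u, 0 ≤ D u := MeromorphicOn.AnalyticOnNhd.divisor_nonneg (hana r)
  have hsum : ∑ ρ ∈ S, (multiplicity ρ : ℤ) ≤ ∑ᶠ u, D u := by
    rw [Finset.sum_congr rfl hD,
      finsum_eq_sum_of_support_subset (s := hfin.toFinset ∪ S) D (by
        intro u hu; simp only [Finset.coe_union, Finite.coe_toFinset]; exact Or.inl hu)]
    exact Finset.sum_le_sum_of_subset_of_nonneg Finset.subset_union_right fun u _ _ ↦ hnn u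
  exact_mod_cast hsum

theorem exists_sum_multiplicity_le :
    ∃ C, ∀ (k : ℕ) (S : Finset ℂ), (∀ ρ ∈ S, ρ ∈ nontrivialZeros) → (∀ ρ ∈ S, ‖ρ‖ ≤ 2 ^ k) →
      ∑ ρ ∈ S, (multiplicity ρ : ℝ) ≤ C * ((k + 1) * 2 ^ k) := by
  obtain ⟨A, hA, h⟩ := exists_norm_xi_le
  have hl : 0 < Real.log 2 := Real.log_pos (by norm_num)
  refine ⟨Real.log A / Real.log 2 + 3, fun k S hS hk ↦ ?_⟩
  have hfpos : 0 < (2 ^ k : ℕ).factorial := Nat.factorial_pos _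
  have hf : (1 : ℝ) ≤ (2 ^ k : ℕ).factorial := by exact_mod_cast hfpos
  have hM : 1 ≤ A * 2 ^ (2 * k) * (2 ^ k : ℕ).factorial :=
    one_le_mul_of_one_le_of_one_le
      (one_le_mul_of_one_le_of_one_le hA (one_le_pow₀ (by norm_num))) hf
  refine (sum_multiplicity_le hS (by positivity) hk hM (h k)).trans ?_
  have hfac : Real.log (2 ^ k : ℕ).factorial ≤ 2 ^ k * (k * Real.log 2) := by
    have : ((2 ^ k : ℕ).factorial : ℝ) ≤ (2 ^ k) ^ (2 ^ k) := by
      exact_mod_cast Nat.factorial_le_pow (2 ^ k)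
    refine (Real.log_le_log (by positivity) this).trans_eq ?_
    rw [Real.log_pow, Real.log_pow]
    push_cast
    ring
  rw [Real.log_mul (by positivity) (by positivity), Real.log_mul (by positivity) (by positivity),
    Real.log_pow, div_le_iff₀ hl]
  have hx : (1 : ℝ) ≤ 2 ^ k := one_le_pow₀ (by norm_num)
  have hk1 : (1 : ℝ) ≤ (k + 1) * 2 ^ k := by
    have : (0 : ℝ) ≤ k := k.cast_nonneg
    nlinarith
  have hlA : 0 ≤ Real.log A := Real.log_nonneg hA
  have e : (Real.log A / Real.log 2 + 3) * ((k + 1) * 2 ^ k) * Real.log 2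
      = Real.log A * ((k + 1) * 2 ^ k) + 3 * ((k + 1) * 2 ^ k) * Real.log 2 := by
    field_simp
  rw [e]
  have h1 : Real.log A ≤ Real.log A * ((k + 1) * 2 ^ k) := le_mul_of_one_le_right hlA hk1
  have h2 : (2 * k + 2 ^ k * k) * Real.log 2 ≤ 3 * ((k + 1) * 2 ^ k) * Real.log 2 := by
    gcongr
    have : (0 : ℝ) ≤ k := k.cast_nonneg
    nlinarith
  push_cast
  linarith

theorem exists_le_norm_of_mem : ∃ δ : ℝ, 0 < δ ∧ ∀ ρ ∈ nontrivialZeros, δ ≤ ‖ρ‖ := by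
  have h : ∀ᶠ z in 𝓝 (0 : ℂ), xi z ≠ 0 :=
    differentiable_xi.continuous.continuousAt.eventually_ne (by simp)
  obtain ⟨δ, hδ, hz⟩ := Metric.eventually_nhds_iff.1 h
  refine ⟨δ, hδ, fun ρ hρ ↦ le_of_not_gt fun hlt ↦ ?_⟩
  exact hz (by simpa using hlt) (mem_nontrivialZeros_iff.1 hρ).1

/-- The series `∑_ρ m(ρ) / |ρ|²` over the nontrivial zeros converges. -/
theorem summable_multiplicity_div_norm_sq :
    Summable fun ρ : nontrivialZeros ↦ (multiplicity (ρ : ℂ) : ℝ) / ‖(ρ : ℂ)‖ ^ 2 := by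
  obtain ⟨C, hC⟩ := exists_sum_multiplicity_le
  obtain ⟨δ, hδ, hδρ⟩ := exists_le_norm_of_mem
  have hex (x : ℝ) : ∃ k : ℕ, x ≤ 2 ^ k :=
    (pow_unbounded_of_one_lt x one_lt_two).imp fun _ ↦ le_of_lt
  classical
  let g : ℂ → ℕ := fun ρ ↦ Nat.find (hex ‖ρ‖)
  have hg (ρ : ℂ) : ‖ρ‖ ≤ 2 ^ g ρ := Nat.find_spec (hex ‖ρ‖)
  -- `1/δ` covers zeros with `g ρ = 0`; the `2` comes from minimality of `g ρ` otherwise.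
  set K := 1 / δ + 2
  have hK : 0 < K := by positivity
  have hgK (ρ : ℂ) (hρ : ρ ∈ nontrivialZeros) : 2 ^ g ρ ≤ K * ‖ρ‖ := by
    have h1 := hδρ ρ hρ
    have h2 : 1 ≤ 1 / δ * ‖ρ‖ := by rw [one_div_mul_eq_div]; exact (one_le_div hδ).2 h1
    have h3 : K * ‖ρ‖ = 1 / δ * ‖ρ‖ + 2 * ‖ρ‖ := by ring
    rcases Nat.eq_zero_or_pos (g ρ) with h0 | h0
    · rw [h0, pow_zero, h3]
      linarith [norm_nonneg ρ]
    · obtain ⟨j, hj⟩ := Nat.exists_eq_succ_of_ne_zero h0.ne'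
      have := Nat.find_min (hex ‖ρ‖) (m := j) (by change j < g ρ; omega)
      rw [hj, pow_succ, h3]
      linarith [not_le.1 this]
  have hser : Summable fun k : ℕ ↦ C * ((k + 1) * (1 / 2 : ℝ) ^ k) := by
    have h1 := summable_pow_mul_geometric_of_norm_lt_one 1 (r := (1 / 2 : ℝ)) (by norm_num)
    have h2 := summable_geometric_of_lt_one (r := (1 / 2 : ℝ)) (by norm_num) (by norm_num)
    refine ((h1.add h2).congr fun k ↦ ?_).mul_left C
    rw [pow_one]; ring
  have hC0 : 0 ≤ C := by
    have := hC 0 ∅ (by simp) (by simp)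
    simpa using this
  refine summable_of_sum_le (c := K ^ 2 * ∑' k : ℕ, C * ((k + 1) * (1 / 2 : ℝ) ^ k))
    (fun ρ ↦ by positivity) fun s ↦ ?_
  set S : Finset ℂ := s.map (Function.Embedding.subtype _)
  have hS : ∀ ρ ∈ S, ρ ∈ nontrivialZeros := by
    intro ρ hρ
    obtain ⟨x, -, rfl⟩ := Finset.mem_map.1 hρ
    exact x.2
  calc ∑ ρ ∈ s, (multiplicity (ρ : ℂ) : ℝ) / ‖(ρ : ℂ)‖ ^ 2
      = ∑ ρ ∈ S, (multiplicity ρ : ℝ) / ‖ρ‖ ^ 2 := by simp [S]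
    _ ≤ ∑ ρ ∈ S, K ^ 2 * ((multiplicity ρ : ℝ) * (1 / 4) ^ g ρ) := by
        refine Finset.sum_le_sum fun ρ hρ ↦ ?_
        have h0 : 0 < ‖ρ‖ := norm_pos_iff.2 (ne_zero_of_mem (hS ρ hρ))
        have h1 := hgK ρ (hS ρ hρ)
        have h2 : ((2 : ℝ) ^ g ρ) ^ 2 ≤ (K * ‖ρ‖) ^ 2 := by gcongr
        have h3 : ((1 : ℝ) / 4) ^ g ρ = 1 / (2 ^ g ρ) ^ 2 := by
          rw [← pow_mul, mul_comm, pow_mul, one_div_pow]; norm_num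
        have h4 : 1 / ‖ρ‖ ^ 2 ≤ K ^ 2 * (1 / (2 ^ g ρ) ^ 2) := by
          rw [mul_one_div, div_le_div_iff₀ (by positivity) (by positivity)]
          nlinarith
        rw [h3, div_eq_mul_one_div]
        calc (multiplicity ρ : ℝ) * (1 / ‖ρ‖ ^ 2)
            ≤ multiplicity ρ * (K ^ 2 * (1 / (2 ^ g ρ) ^ 2)) := by gcongr
          _ = _ := by ring
    _ = K ^ 2 * ∑ k ∈ S.image g, ∑ ρ ∈ S with g ρ = k, (multiplicity ρ : ℝ) * (1 / 4) ^ g ρ := by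
        rw [← Finset.mul_sum, Finset.sum_fiberwise_of_maps_to
          (fun ρ hρ ↦ Finset.mem_image_of_mem g hρ)]
    -- Each shell has `O((k+1) 2^k)` zeros, each weighted by `4^(-k)`.
    _ ≤ K ^ 2 * ∑ k ∈ S.image g, C * ((k + 1) * (1 / 2 : ℝ) ^ k) := by
        gcongr with k hk
        have h1 : ∑ ρ ∈ S with g ρ = k, (multiplicity ρ : ℝ) * (1 / 4) ^ g ρ
            = (∑ ρ ∈ S with g ρ = k, (multiplicity ρ : ℝ)) * (1 / 4) ^ k := by
          rw [Finset.sum_mul]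
          exact Finset.sum_congr rfl fun ρ hρ ↦ by rw [(Finset.mem_filter.1 hρ).2]
        have h2 := hC k (S.filter (g · = k)) (fun ρ hρ ↦ hS ρ (Finset.mem_filter.1 hρ).1)
          (fun ρ hρ ↦ (Finset.mem_filter.1 hρ).2 ▸ hg ρ)
        rw [h1]
        calc _ ≤ C * ((k + 1) * 2 ^ k) * (1 / 4 : ℝ) ^ k := by gcongr
          _ = C * ((k + 1) * (2 * (1 / 4)) ^ k) := by rw [mul_pow]; ring
          _ = _ := by norm_num
    _ ≤ K ^ 2 * ∑' k : ℕ, C * ((k + 1) * (1 / 2 : ℝ) ^ k) := by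
        gcongr
        exact hser.sum_le_tsum _ fun k _ ↦ by positivity

end LiKeiper

namespace LiKeiper

/-! ### Sums over the zeros -/

@[simp]
theorem mem_zerosUpTo {T : ℝ} {ρ : ℂ} : ρ ∈ zerosUpTo T ↔ ρ ∈ nontrivialZeros ∧ |ρ.im| ≤ T := by
  simp [zerosUpTo]

/-- `limUnder` is meaningful only once some limit is known to exist. -/
theorem tendsto_zeroSum_of_tendsto {f : ℂ → ℂ} {L : ℂ} (h : Tendsto (partialSum f) atTop (𝓝 L)) :
    Tendsto (partialSum f) atTop (𝓝 (zeroSum f)) :=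
  tendsto_nhds_limUnder ⟨L, h⟩

theorem tendsto_partialSum_of_summable {f : ℂ → ℂ}
    (h : Summable fun ρ : nontrivialZeros ↦ (multiplicity (ρ : ℂ) : ℂ) * f ρ) :
    Tendsto (partialSum f) atTop
      (𝓝 (∑' ρ : nontrivialZeros, (multiplicity (ρ : ℂ) : ℂ) * f ρ)) := by
  classical
  let Z : ℝ → Finset nontrivialZeros := fun T ↦ (zerosUpTo T).subtype (· ∈ nontrivialZeros)
  have hZ : Tendsto Z atTop atTop := by
    refine tendsto_atTop_finset_of_monotone (fun T T' hT ρ hρ ↦ ?_) fun ρ ↦ ⟨|(ρ : ℂ).im|, ?_⟩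
    · simp only [Z, Finset.mem_subtype, mem_zerosUpTo] at hρ ⊢
      exact ⟨hρ.1, hρ.2.trans hT⟩
    · simp [Z]
  refine (h.hasSum.comp hZ).congr fun T ↦ ?_
  exact Finset.sum_subtype_of_mem (fun ρ ↦ (multiplicity ρ : ℂ) * f ρ)
    fun ρ hρ ↦ (mem_zerosUpTo.1 hρ).1

theorem hasSum_zeroSum_of_summable {f : ℂ → ℂ}
    (h : Summable fun ρ : nontrivialZeros ↦ (multiplicity (ρ : ℂ) : ℂ) * f ρ) :
    HasSum (fun ρ : nontrivialZeros ↦ (multiplicity (ρ : ℂ) : ℂ) * f ρ) (zeroSum f) := by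
  rw [zeroSum, (tendsto_partialSum_of_summable h).limUnder_eq]
  exact h.hasSum

/-- The window `|Im ρ| ≤ T` is stable under `ρ ↦ 1 - ρ`, which negates `Im ρ` and preserves
multiplicity. -/
theorem partialSum_comp_one_sub (f : ℂ → ℂ) (T : ℝ) :
    partialSum (fun ρ ↦ f (1 - ρ)) T = partialSum f T := by
  have hmem : ∀ ρ ∈ zerosUpTo T, 1 - ρ ∈ zerosUpTo T := fun ρ hρ ↦ by
    rw [mem_zerosUpTo] at hρ ⊢
    exact ⟨one_sub_mem_nontrivialZeros hρ.1, by simpa using hρ.2⟩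
  refine Finset.sum_nbij' (1 - ·) (1 - ·) hmem hmem (by simp) (by simp) fun ρ hρ ↦ ?_
  rw [multiplicity_one_sub (mem_zerosUpTo.1 hρ).1]

/-- The involution `ρ ↦ 1 - ρ` of the set of nontrivial zeros. -/
def oneSubEquiv : nontrivialZeros ≃ nontrivialZeros where
  toFun ρ := ⟨1 - ρ, one_sub_mem_nontrivialZeros ρ.2⟩
  invFun ρ := ⟨1 - ρ, one_sub_mem_nontrivialZeros ρ.2⟩
  left_inv ρ := by simp
  right_inv ρ := by simp

theorem summable_multiplicity_div_norm_one_sub_sq :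
    Summable fun ρ : nontrivialZeros ↦ (multiplicity (ρ : ℂ) : ℝ) / ‖1 - (ρ : ℂ)‖ ^ 2 := by
  refine (oneSubEquiv.summable_iff.2 summable_multiplicity_div_norm_sq).congr fun ρ ↦ ?_
  simp [oneSubEquiv, multiplicity_one_sub ρ.2]

theorem summable_multiplicity_mul_inv_mul_inv_one_sub :
    Summable fun ρ : nontrivialZeros ↦
      (multiplicity (ρ : ℂ) : ℂ) * ((ρ : ℂ)⁻¹ * (1 - (ρ : ℂ))⁻¹) := by
  refine Summable.of_norm_bounded
    (summable_multiplicity_div_norm_sq.add summable_multiplicity_div_norm_one_sub_sq) fun ρ ↦ ?_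
  rw [norm_mul, norm_mul, norm_inv, norm_inv, Complex.norm_natCast, div_eq_mul_inv, div_eq_mul_inv,
    ← mul_add, ← inv_pow, ← inv_pow]
  gcongr
  nlinarith [sq_nonneg (‖(ρ : ℂ)‖⁻¹ - ‖1 - (ρ : ℂ)‖⁻¹), sq_nonneg ‖(ρ : ℂ)‖⁻¹,
    sq_nonneg ‖1 - (ρ : ℂ)‖⁻¹]

/-- The series `∑_ρ m(ρ) / ρ ^ n` with `n ≥ 2` converges absolutely. -/
theorem summable_multiplicity_mul_deltaTerm {n : ℕ} (hn : 1 < n) :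
    Summable fun ρ : nontrivialZeros ↦ (multiplicity (ρ : ℂ) : ℂ) * deltaTerm n ρ := by
  obtain ⟨δ, hδ, hδρ⟩ := exists_le_norm_of_mem
  -- Write `n = j + 2`: two powers give the summable series, the others are bounded by `δ⁻¹`.
  obtain ⟨j, rfl⟩ := Nat.exists_eq_add_of_lt hn
  refine Summable.of_norm_bounded (summable_multiplicity_div_norm_sq.mul_left ((δ⁻¹) ^ j))
    fun ρ ↦ ?_
  have h1 : ‖(ρ : ℂ)‖⁻¹ ≤ δ⁻¹ := inv_anti₀ hδ (hδρ ρ ρ.2)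
  rw [deltaTerm, norm_mul, norm_mul, norm_zpow, norm_neg, norm_one, one_zpow, one_mul, one_div,
    norm_inv, norm_pow, Complex.norm_natCast, div_eq_mul_inv, ← inv_pow, ← inv_pow,
    show 1 + j + 1 = j + 2 by ring, pow_add, mul_left_comm]
  gcongr

/-- The sum `∑_ρ 1 / ρ` converges, the zeros being grouped symmetrically. -/
theorem exists_tendsto_partialSum_liTerm_one :
    ∃ L, Tendsto (partialSum (liTerm 1)) atTop (𝓝 L) := by
  have h := (tendsto_partialSum_of_summable (f := fun ρ ↦ ρ⁻¹ * (1 - ρ)⁻¹)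
    summable_multiplicity_mul_inv_mul_inv_one_sub).const_mul (1 / 2)
  refine ⟨_, h.congr fun T ↦ ?_⟩
  have h1 : partialSum (fun ρ ↦ ρ⁻¹ * (1 - ρ)⁻¹) T
      = partialSum (liTerm 1) T + partialSum (fun ρ ↦ liTerm 1 (1 - ρ)) T := by
    rw [partialSum, partialSum, partialSum, ← Finset.sum_add_distrib]
    refine Finset.sum_congr rfl fun ρ hρ ↦ ?_
    have hρ' := (mem_zerosUpTo.1 hρ).1
    have h0 := ne_zero_of_mem hρ'
    have h2 : 1 - ρ ≠ 0 := sub_ne_zero.2 (ne_one_of_mem hρ').symm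
    simp only [liTerm]
    field_simp
    ring
  rw [h1, partialSum_comp_one_sub]
  ring

/-! ### The binomial identity -/

theorem neg_one_zpow_eq_pow_mul_pow (k n : ℕ) :
    (-1 : ℂ) ^ ((k : ℤ) - (n : ℤ) + 1) = -((-1) ^ k * (-1) ^ n) := by
  have h : (-1 : ℂ) ≠ 0 := by norm_num
  rw [zpow_add₀ h, zpow_sub₀ h, zpow_natCast, zpow_natCast, zpow_one, div_eq_mul_inv, ← inv_pow,
    inv_neg_one]
  ring

theorem one_sub_pow_eq_sum (x : ℂ) {n : ℕ} (hn : 1 ≤ n) :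
    1 - x ^ n = ∑ k ∈ Finset.Ico 1 n,
        (-1 : ℂ) ^ ((k : ℤ) - (n : ℤ) + 1) * (n.choose k : ℂ) * (1 - x ^ k)
      + (-1 : ℂ) ^ ((n : ℤ) - 1) * (1 - x) ^ n := by
  have hsq : (-1 : ℂ) ^ n * (-1) ^ n = 1 := by rw [← mul_pow]; norm_num
  have hbin (y : ℂ) : ∑ k ∈ Finset.range (n + 1), (-1 : ℂ) ^ k * n.choose k * y ^ k
      = (1 - y) ^ n := by
    rw [sub_eq_neg_add, add_pow]
    refine Finset.sum_congr rfl fun k _ ↦ ?_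
    rw [one_pow, neg_pow]
    ring
  have h1 : ∑ k ∈ Finset.range (n + 1), (-1 : ℂ) ^ k * n.choose k * (1 - x ^ k)
      = -(1 - x) ^ n := by
    -- At `y = 1` the alternating binomial sum is `0 ^ n`, which vanishes as `n ≥ 1`.
    have h := hbin 1
    simp only [one_pow, mul_one, sub_self, zero_pow (by omega : n ≠ 0)] at h
    simp only [mul_sub, mul_one, Finset.sum_sub_distrib, hbin, h, zero_sub]
  rw [Finset.sum_range_succ, ← Nat.Ico_zero_eq_range, Finset.sum_eq_sum_Ico_succ_bot (by omega)] at h1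
  simp only [pow_zero, sub_self, mul_zero, zero_add, Nat.choose_self, Nat.cast_one, mul_one] at h1
  have h2 : ∑ k ∈ Finset.Ico 1 n,
        (-1 : ℂ) ^ ((k : ℤ) - (n : ℤ) + 1) * (n.choose k : ℂ) * (1 - x ^ k)
      = -(-1) ^ n * ∑ k ∈ Finset.Ico 1 n, (-1 : ℂ) ^ k * n.choose k * (1 - x ^ k) := by
    rw [Finset.mul_sum]
    refine Finset.sum_congr rfl fun k _ ↦ ?_
    rw [neg_one_zpow_eq_pow_mul_pow]
    ring
  have h3 : (-1 : ℂ) ^ ((n : ℤ) - 1) = -(-1) ^ n := by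
    rw [zpow_sub₀ (by norm_num), zpow_natCast, zpow_one, div_neg, div_one]
  rw [h2, h3]
  linear_combination (-1 : ℂ) ^ n * h1 - (1 - x ^ n) * hsq

theorem liTerm_eq_sum_add_deltaTerm {n : ℕ} (hn : 1 ≤ n) (ρ : ℂ) :
    liTerm n ρ = ∑ k ∈ Finset.Ico 1 n,
        (-1 : ℂ) ^ ((k : ℤ) - (n : ℤ) + 1) * (n.choose k : ℂ) * liTerm k ρ
      + deltaTerm n ρ := by
  have h := one_sub_pow_eq_sum (1 - 1 / ρ) hn
  rwa [sub_sub_cancel, one_div_pow] at h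

theorem partialSum_liTerm {n : ℕ} (hn : 1 ≤ n) (T : ℝ) :
    partialSum (liTerm n) T = ∑ k ∈ Finset.Ico 1 n,
        (-1 : ℂ) ^ ((k : ℤ) - (n : ℤ) + 1) * (n.choose k : ℂ) * partialSum (liTerm k) T
      + partialSum (deltaTerm n) T := by
  simp only [partialSum, Finset.mul_sum]
  rw [Finset.sum_comm, ← Finset.sum_add_distrib]
  refine Finset.sum_congr rfl fun ρ _ ↦ ?_
  rw [liTerm_eq_sum_add_deltaTerm hn, mul_add, Finset.mul_sum]
  congr 1
  exact Finset.sum_congr rfl fun k _ ↦ by ring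

/-! ### Passage to the limit in the recurrence -/

theorem tendsto_partialSum_deltaTerm {n : ℕ} (hn : 1 < n) :
    Tendsto (partialSum (deltaTerm n)) atTop (𝓝 (delta n)) :=
  tendsto_zeroSum_of_tendsto
    (tendsto_partialSum_of_summable (summable_multiplicity_mul_deltaTerm hn))

theorem tendsto_partialSum_liTerm_sum {n : ℕ} (hn : 1 < n)
    (h : ∀ k ∈ Finset.Ico 1 n, Tendsto (partialSum (liTerm k)) atTop (𝓝 (liKeiper k))) :
    Tendsto (partialSum (liTerm n)) atTop (𝓝 (∑ k ∈ Finset.Ico 1 n,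
        (-1 : ℂ) ^ ((k : ℤ) - (n : ℤ) + 1) * (n.choose k : ℂ) * liKeiper k + delta n)) := by
  refine Tendsto.congr (fun T ↦ (partialSum_liTerm hn.le T).symm) ?_
  exact (tendsto_finsetSum _ fun k hk ↦ (h k hk).const_mul _).add (tendsto_partialSum_deltaTerm hn)

theorem tendsto_partialSum_liTerm {n : ℕ} (hn : 1 ≤ n) :
    Tendsto (partialSum (liTerm n)) atTop (𝓝 (liKeiper n)) := by
  induction n using Nat.strong_induction_on with
  | _ n ih =>
    rcases hn.eq_or_lt with rfl | h
    · exact tendsto_zeroSum_of_tendsto exists_tendsto_partialSum_liTerm_one.choose_spec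
    · refine tendsto_zeroSum_of_tendsto (tendsto_partialSum_liTerm_sum h fun k hk ↦ ?_)
      rw [Finset.mem_Ico] at hk
      exact ih k hk.2 hk.1

end LiKeiper

theorem mainTheorem1 :
    -- the sums over the zeros that define `λ(n)` converge
    (∀ n : ℕ, 1 ≤ n →
      Tendsto (LiKeiper.partialSum (LiKeiper.liTerm n)) atTop (𝓝 (LiKeiper.liKeiper n))) ∧
    -- the sums that define `Δ(n)`, `n > 1`, converge absolutely
    (∀ n : ℕ, 1 < n →
      HasSum (fun ρ : LiKeiper.nontrivialZeros =>
        (LiKeiper.multiplicity (ρ : ℂ) : ℂ) * LiKeiper.deltaTerm n (ρ : ℂ))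
        (LiKeiper.delta n)) ∧
    -- the binomial identity for each single zero
    (∀ n : ℕ, 1 < n → ∀ ρ ∈ LiKeiper.nontrivialZeros,
      LiKeiper.liTerm n ρ =
        ∑ k ∈ Finset.Ico 1 n,
          (-1 : ℂ) ^ ((k : ℤ) - (n : ℤ) + 1) * (n.choose k : ℂ) * LiKeiper.liTerm k ρ
        + LiKeiper.deltaTerm n ρ) ∧
    -- the closed system for the coefficients
    (∀ n : ℕ, 1 < n →
      LiKeiper.liKeiper n =
        ∑ k ∈ Finset.Ico 1 n,
          (-1 : ℂ) ^ ((k : ℤ) - (n : ℤ) + 1) * (n.choose k : ℂ) * LiKeiper.liKeiper k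
        + LiKeiper.delta n) :=
  ⟨fun _ hn ↦ LiKeiper.tendsto_partialSum_liTerm hn,
    fun _ hn ↦ LiKeiper.hasSum_zeroSum_of_summable
      (LiKeiper.summable_multiplicity_mul_deltaTerm hn),
    fun _ hn ρ _ ↦ LiKeiper.liTerm_eq_sum_add_deltaTerm hn.le ρ,
    fun _ hn ↦ tendsto_nhds_unique (LiKeiper.tendsto_partialSum_liTerm hn.le)
      (LiKeiper.tendsto_partialSum_liTerm_sum hn fun _ hk ↦
        LiKeiper.tendsto_partialSum_liTerm (Finset.mem_Ico.1 hk).1)⟩
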